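/- Consider the generalized $2+1$ Zoomeron equation $$\Big(\frac{u_{xy}}{f(u)}\Big)_{tt}-\Big(\frac{u_{xy}}{f(u)}\Big)_{xx}+2\,\big(g(u)\big)_{xt}=0 \qquad (*)$$ for $u=u(t,x,y)$ with values in an open interval $I\subseteq\mathbb R$, where $f,g\colon I\to\mathbb R$ are smooth and nonconstant and $f$ has no zero. Write $(*)$ as $H=0$ on the jet space. A smooth vector field $X=\xi^t\partial_t+\xi^x\partial_x+\xi^y\partial_y+\eta\,\partial_u$, with coefficients depending on $(t,x,y,u)$, is a Lie point symmetry of $(*)$ if its fourth prolongation satisfies $X^{[4]}H=0$ wherever $H=0$. For all such $I,f,g$, every element of the span $G_4$ of $Y_1=\partial_t$, $Y_2=\partial_x$, $Y_3=\partial_y$, $Y_4=t\partial_t+x\partial_x-y\partial_y$ is a Lie point symmetry of $(*)$. These four fields are linearly independent, and their nonzero commutators are $[Y_1,Y_4]=Y_1$, $[Y_2,Y_4]=Y_2$, $[Y_3,Y_4]=-Y_3$. So $G_4$ is a Lie algebra of type $A_{4,5}^{ab}$, which means that it has a basis $e_1,\dots,e_4$ with nonzero commutators $[e_1,e_4]=e_1$,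 $[e_2,e_4]=a\,e_2$, $[e_3,e_4]=b\,e_3$, where $ab\neq0$ and $-1\le a\le b\le 1$; here $(a,b)=(-1,1)$. In each of the following four cases, with real constants $f_0,K,g_1\neq0$ and $g_0$, the equation $(*)$ admits an additional Lie point symmetry $Y_5$. (I) $I=(0,\infty)$, $f(u)=f_0u^K$, $g(u)=g_0+g_1u^{-\frac1{\alpha_1}-(K-1)}$ with $\alpha_1\neq0$ and nonzero exponent; $Y_5=y\partial_y+\alpha_1u\,\partial_u$. (II) $I=(0,\infty)$, $f(u)=f_0u^K$ with $K\ne1$, $g(u)=g_0+g_1\ln u$; $Y_5=y\partial_y+\frac1{1-K}u\,\partial_u$. (III) $I=\mathbb R$, $f(u)=f_0e^{Ku}$, $g(u)=g_0+g_1e^{-(K+\frac2{\alpha_2})u}$ with $\alpha_2\neq0$ and $K+\frac2{\alpha_2}\neq0$; $Y_5=y\partial_y+\frac{\alpha_2}2\,\partial_u$. (IV) $I=\mathbb R$, $f(u)=f_0e^{Ku}$, $g(u)=g_0+g_1u$; $Y_5=y\partial_y-\frac1K\,\partial_u$. In each case $Y_1,\dots,Y_5$ are linearly independent, every element of their span is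 a Lie point symmetry of $(*)$, the only nonzero commutator of $Y_5$ with $Y_1,\dots,Y_4$ is $[Y_3,Y_5]=Y_3$, and the span is a Lie algebra of type $3A_1\otimes_s2A_1$, that is, the semidirect sum of a three-dimensional abelian ideal and a two-dimensional abelian subalgebra. Conversely, let $I,f,g$ be as in the first paragraph. If $I\subseteq(0,\infty)$ and $y\partial_y+\beta u\,\partial_u$ ($\beta\in\mathbb R$) is a Lie point symmetry of $(*)$, then on $I$ the functions $f,g$ are as in (I) with $\alpha_1=\beta$, or as in (II) with $\frac1{1-K}=\beta$. If $y\partial_y+\gamma\,\partial_u$ ($\gamma\in\mathbb R$) is a Lie point symmetry of $(*)$, then on $I$ the functions $f,g$ are as in (III) with $\frac{\alpha_2}2=\gamma$, or as in (IV) with $-\frac1K=\gamma$. -/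

import Mathlib

open Set
open scoped ContDiff

noncomputable section

/-- Points of the infinite jet space of real functions `u` of the three independent variables
`(t, x, y)`, numbered `0, 1, 2`. The first component is the base point `(t, x, y)`; the second one
lists the jet coordinates `u_α`, one for each multi-index `α` (so `u_0` is `u` itself). A
differential function of order `n` is a function of finitely many of these coordinates, those with
`|α| ≤ n`. -/
abbrev Jet : Type := (Fin 3 → ℝ) × ((Fin 3 → ℕ) → ℝ)

/-- The multi-index of the first derivative in the direction `i`. -/
abbrev unitIndex (i : Fin 3) : Fin 3 → ℕ := Pi.single i 1

/-- The total derivative `D_i F = ∂F/∂x_i + ∑_α u_{α + e_i} ∂F/∂u_α`, written as the derivative of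
`F` along the direction whose base component is `e_i` and whose `u_α`-component is
`u_{α + e_i}`. -/
def totalDeriv (i : Fin 3) (F : Jet → ℝ) (z : Jet) : ℝ :=
  deriv (fun s : ℝ => F (z.1 + s • Pi.single i (1 : ℝ),
    z.2 + s • (fun α => z.2 (α + unitIndex i)))) 0

/-- The iterated total derivative `D_α = D_t^{α_0} D_x^{α_1} D_y^{α_2}`. -/
def iterTotalDeriv (α : Fin 3 → ℕ) (F : Jet → ℝ) : Jet → ℝ :=
  (totalDeriv 0)^[α 0] ((totalDeriv 1)^[α 1] ((totalDeriv 2)^[α 2] F))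

/-- The left-hand side `(u_{xy}/f(u))_{tt} - (u_{xy}/f(u))_{xx} + 2 (g(u))_{xt}` of the generalized
2+1 Zoomeron equation, as a differential function. -/
def zoomeron (f g : ℝ → ℝ) (z : Jet) : ℝ :=
  totalDeriv 0 (totalDeriv 0 fun w => w.2 ![0, 1, 1] / f (w.2 0)) z
    - totalDeriv 1 (totalDeriv 1 fun w => w.2 ![0, 1, 1] / f (w.2 0)) z
    + 2 * totalDeriv 0 (totalDeriv 1 fun w => g (w.2 0)) z

/-- Vector fields `ξ^t ∂_t + ξ^x ∂_x + ξ^y ∂_y + η ∂_u` on the space of the variables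
`(t, x, y, u)`, numbered `0, 1, 2, 3`. -/
abbrev PointField : Type := (Fin 4 → ℝ) → (Fin 4 → ℝ)

/-- The point `(t, x, y, u)` below a jet. -/
def Jet.point (z : Jet) : Fin 4 → ℝ := ![z.1 0, z.1 1, z.1 2, z.2 0]

/-- The components `(ξ^t, ξ^x, ξ^y)` of a vector field at the point below a jet. -/
def PointField.base (X : PointField) (z : Jet) : Fin 3 → ℝ := fun i => X z.point i.castSucc

/-- The characteristic `Q = η - ξ^t u_t - ξ^x u_x - ξ^y u_y` of a vector field. -/
def PointField.characteristic (X : PointField) (z : Jet) : ℝ :=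
  X z.point 3 - ∑ i, X.base z i * z.2 (unitIndex i)

/-- The prolongation coefficients `η^α = D_α Q + ∑_i ξ^i u_{α + e_i}`; in particular
`η^0 = η`. -/
def PointField.prolongCoeff (X : PointField) (z : Jet) (α : Fin 3 → ℕ) : ℝ :=
  iterTotalDeriv α X.characteristic z + ∑ i, X.base z i * z.2 (α + unitIndex i)

/-- The action of the prolonged vector field
`X^{[n]} = ∑_i ξ^i ∂/∂x_i + ∑_α η^α ∂/∂u_α` on a differential function `F` (of any order `n`),
written as the derivative of `F` in this direction. -/
def PointField.prolong (X : PointField) (F : Jet → ℝ) (z : Jet) : ℝ :=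
  deriv (fun s : ℝ => F (z.1 + s • X.base z, z.2 + s • X.prolongCoeff z)) 0

/-- `X` is a Lie point symmetry of the generalized 2+1 Zoomeron equation `H = 0`, for dependent
variables `u` with values in `I`: it is smooth and `X^{[4]} H = 0` holds wherever `H = 0`. -/
def IsLieSymmetry (I : Set ℝ) (f g : ℝ → ℝ) (X : PointField) : Prop :=
  ContDiffOn ℝ ∞ X {p | p 3 ∈ I} ∧
    ∀ z : Jet, z.2 0 ∈ I → zoomeron f g z = 0 → X.prolong (zoomeron f g) z = 0

/-- The standing assumptions on the functions in the equation: `I` is an open interval, on which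
`f` and `g` are smooth and nonconstant, and `f` has no zero. -/
structure Admissible (I : Set ℝ) (f g : ℝ → ℝ) : Prop where
  isOpen : IsOpen I
  isPreconnected : IsPreconnected I
  smooth_f : ContDiffOn ℝ ∞ f I
  smooth_g : ContDiffOn ℝ ∞ g I
  f_ne_zero : ∀ u ∈ I, f u ≠ 0
  f_nonconstant : ¬ ∃ c, ∀ u ∈ I, f u = c
  g_nonconstant : ¬ ∃ c, ∀ u ∈ I, g u = c

/-- `∂_t` -/
def Y₁ : PointField := fun _ => ![1, 0, 0, 0]

/-- `∂_x` -/
def Y₂ : PointField := fun _ => ![0, 1, 0, 0]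

/-- `∂_y` -/
def Y₃ : PointField := fun _ => ![0, 0, 1, 0]

/-- `t ∂_t + x ∂_x - y ∂_y` -/
def Y₄ : PointField := fun p => ![p 0, p 1, -p 2, 0]

/-- `y ∂_y + β u ∂_u` -/
def scalingField (β : ℝ) : PointField := fun p => ![0, 0, p 2, β * p 3]

/-- `y ∂_y + γ ∂_u` -/
def translationField (γ : ℝ) : PointField := fun p => ![0, 0, p 2, γ]

/-- The Lie bracket of vector fields on `(t, x, y, u)`-space. -/
abbrev bracket (X Y : PointField) : PointField := VectorField.lieBracket ℝ X Y

/-- The real vector space `L` of vector fields is a Lie algebra of type `A_{4,5}^{ab}`: it has a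
basis `e₁, e₂, e₃, e₄` whose nonzero commutators are `[e₁, e₄] = e₁`, `[e₂, e₄] = a e₂`,
`[e₃, e₄] = b e₃`, where `ab ≠ 0` and `-1 ≤ a ≤ b ≤ 1`. -/
def IsA45 (a b : ℝ) (L : Submodule ℝ PointField) : Prop :=
  a * b ≠ 0 ∧ -1 ≤ a ∧ a ≤ b ∧ b ≤ 1 ∧
    ∃ e₁ e₂ e₃ e₄ : PointField,
      ContDiff ℝ ∞ e₁ ∧ ContDiff ℝ ∞ e₂ ∧ ContDiff ℝ ∞ e₃ ∧ ContDiff ℝ ∞ e₄ ∧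
      LinearIndependent ℝ ![e₁, e₂, e₃, e₄] ∧
      Submodule.span ℝ {e₁, e₂, e₃, e₄} = L ∧
      bracket e₁ e₂ = 0 ∧ bracket e₁ e₃ = 0 ∧ bracket e₂ e₃ = 0 ∧
      bracket e₁ e₄ = e₁ ∧ bracket e₂ e₄ = a • e₂ ∧ bracket e₃ e₄ = b • e₃

/-- The real vector space `L` of vector fields is a Lie algebra of type `3A₁ ⊗ₛ 2A₁`: a semidirect
sum of a three-dimensional abelian ideal, spanned by `e₁, e₂, e₃`, and a two-dimensional abelian
subalgebra, spanned by `e₄, e₅`. -/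
def Is3A1SemidirectSum2A1 (L : Submodule ℝ PointField) : Prop :=
  ∃ e₁ e₂ e₃ e₄ e₅ : PointField,
    ContDiff ℝ ∞ e₁ ∧ ContDiff ℝ ∞ e₂ ∧ ContDiff ℝ ∞ e₃ ∧ ContDiff ℝ ∞ e₄ ∧ ContDiff ℝ ∞ e₅ ∧
    LinearIndependent ℝ ![e₁, e₂, e₃, e₄, e₅] ∧
    Submodule.span ℝ {e₁, e₂, e₃, e₄, e₅} = L ∧
    bracket e₁ e₂ = 0 ∧ bracket e₁ e₃ = 0 ∧ bracket e₂ e₃ = 0 ∧ bracket e₄ e₅ = 0 ∧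
    ∀ X ∈ ({e₁, e₂, e₃} : Set PointField), ∀ Y ∈ ({e₄, e₅} : Set PointField),
      bracket X Y ∈ Submodule.span ℝ {e₁, e₂, e₃}

/-- `Y₅` is an additional symmetry: `Y₁, …, Y₄, Y₅` are linearly independent, all their linear
combinations are symmetries, the only nonzero commutator of `Y₅` with the other four is
`[Y₃, Y₅] = Y₃`, and the five vector fields span a Lie algebra of type `3A₁ ⊗ₛ 2A₁`. -/
def IsAdditionalSymmetry (I : Set ℝ) (f g : ℝ → ℝ) (Y₅ : PointField) : Prop :=
  LinearIndependent ℝ ![Y₁, Y₂, Y₃, Y₄, Y₅] ∧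
  (∀ X ∈ Submodule.span ℝ {Y₁, Y₂, Y₃, Y₄, Y₅}, IsLieSymmetry I f g X) ∧
  bracket Y₁ Y₅ = 0 ∧ bracket Y₂ Y₅ = 0 ∧ bracket Y₃ Y₅ = Y₃ ∧ bracket Y₄ Y₅ = 0 ∧
  Is3A1SemidirectSum2A1 (Submodule.span ℝ {Y₁, Y₂, Y₃, Y₄, Y₅})

end

/-! All fields involved are affine and diagonal: each component depends only on its own variable.
Their prolongation is a weighted scaling of the jet, `u_α ↦ (n - ∑ α_i m_i) u_α`, plus the constant
`γ` in the `u`-slot (`diagonalField_prolongCoeff`). Put `φ = 1/f` and `η = n u + γ`, and let `t` and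
`x` have equal weight. Every monomial of `H` is multiplied by its weight while `η d/du` acts on its
coefficient `φ`, `φ'`, `φ''`, `g'` or `g''`. If `φ' η = κ φ` and `(g' η)' = (n - m_0 - m_2 + κ) g'`,
differentiation gives the matching identities for the higher derivatives, and the prolonged field
multiplies `H` by `n - 3 m_0 - m_2 + κ`; this is invariance (`isLieSymmetry_diagonalField`).

Conversely, for `y ∂_y + η ∂_u` two choices of jets on `H = 0` with few nonzero coordinates recover
both equations (`determining_equations`): one gives `(φ' η / φ)' = 0`, so that `κ` is constant
because `I` is connected, and the other gives the equation for `g'`. These are first-order linear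
ODEs for `φ` and `g'`. With `η = β u` the solutions are powers, with `η = γ` exponentials;
integrating `g'` produces the logarithmic or linear case exactly when the exponent of `g`
degenerates to zero. Nonconstancy of `f` and `g` excludes the zero constants. -/

/-! ### Prolongation of diagonal affine fields -/

/-- The vector field `∑ i, (c i + m i x_i) ∂_i + (n u + γ) ∂_u`. -/
def diagonalField (c m : Fin 3 → ℝ) (n γ : ℝ) : PointField :=
  fun p => ![c 0 + m 0 * p 0, c 1 + m 1 * p 1, c 2 + m 2 * p 2, n * p 3 + γ]

theorem diagonalField_base (c m : Fin 3 → ℝ) (n γ : ℝ) (z : Jet) (i : Fin 3) :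
    (diagonalField c m n γ).base z i = c i + m i * z.1 i := by
  fin_cases i <;> rfl

theorem hasDerivAt_jet_coord (z v : (Fin 3 → ℕ) → ℝ) (α : Fin 3 → ℕ) :
    HasDerivAt (fun s : ℝ => (z + s • v) α) (v α) 0 := by
  simpa using ((hasDerivAt_id (0 : ℝ)).mul_const (v α)).const_add (z α)

theorem hasDerivAt_base_coord (z v : Fin 3 → ℝ) (i : Fin 3) :
    HasDerivAt (fun s : ℝ => (z + s • v) i) (v i) 0 := by
  simpa using ((hasDerivAt_id (0 : ℝ)).mul_const (v i)).const_add (z i)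

/-- The differential function `k u_α + γ - ∑ i, (c i + m i x_i) u_{α + e_i}`. -/
def affineChar (c m : Fin 3 → ℝ) (k γ : ℝ) (α : Fin 3 → ℕ) (z : Jet) : ℝ :=
  k * z.2 α + γ - ∑ i, (c i + m i * z.1 i) * z.2 (α + unitIndex i)

/-- `D_j` shifts every index by `e_j`; its explicit action on `x_j` adds `-m_j u_{α + e_j}`, which
is absorbed in the coefficient `k`. The family is therefore closed under total derivatives, and `γ`
disappears after the first one. -/
theorem totalDeriv_affineChar (c m : Fin 3 → ℝ) (k γ : ℝ) (α : Fin 3 → ℕ) (j : Fin 3) :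
    totalDeriv j (affineChar c m k γ α) = affineChar c m (k - m j) 0 (α + unitIndex j) := by
  funext z
  refine HasDerivAt.deriv ?_
  unfold affineChar
  have h1 := fun β => hasDerivAt_jet_coord z.2 (fun α => z.2 (α + unitIndex j)) β
  have h2 := fun i => hasDerivAt_base_coord z.1 (Pi.single j (1 : ℝ)) i
  have h := (((h1 α).const_mul k).add_const γ).sub
    (HasDerivAt.fun_sum fun i (_ : i ∈ Finset.univ) =>
      (((h2 i).const_mul (m i)).const_add (c i)).mul (h1 (α + unitIndex i)))
  refine h.congr_deriv ?_
  have e : ∀ i, α + unitIndex j + unitIndex i = α + unitIndex i + unitIndex j := fun i =>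
    add_right_comm _ _ _
  simp only [e, Finset.sum_add_distrib, zero_smul, add_zero]
  have : ∑ i, m i * (Pi.single j (1 : ℝ) : Fin 3 → ℝ) i * z.2 (α + unitIndex i)
      = m j * z.2 (α + unitIndex j) := by
    rw [Finset.sum_eq_single j] <;> simp +contextual
  rw [this]
  ring

theorem totalDeriv_iterate_affineChar (c m : Fin 3 → ℝ) (k γ : ℝ) (α : Fin 3 → ℕ) (j : Fin 3)
    (r : ℕ) :
    (totalDeriv j)^[r] (affineChar c m k γ α) =
      affineChar c m (k - r * m j) (if r = 0 then γ else 0) (α + r • unitIndex j) := by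
  induction r with
  | zero => simp
  | succ r ih =>
    rw [Function.iterate_succ_apply', ih, totalDeriv_affineChar]
    simp only [Nat.add_eq_zero_iff, one_ne_zero, and_false, if_false]
    congr 1
    · push_cast; ring
    · rw [add_assoc, succ_nsmul]

theorem diagonalField_characteristic (c m : Fin 3 → ℝ) (n γ : ℝ) :
    (diagonalField c m n γ).characteristic = affineChar c m n γ 0 := by
  funext z
  simp only [PointField.characteristic, affineChar, diagonalField_base, zero_add]
  rfl

/-- The sum `∑ ξ^i u_{α + e_i}` cancels the transport part of `D_α Q`, so only the weight of `u_α`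
remains. -/
theorem diagonalField_prolongCoeff (c m : Fin 3 → ℝ) (n γ : ℝ) (z : Jet) (α : Fin 3 → ℕ) :
    (diagonalField c m n γ).prolongCoeff z α =
      (n - ∑ i, α i * m i) * z.2 α + if α = 0 then γ else 0 := by
  have hα : (0 : Fin 3 → ℕ) + α 2 • unitIndex 2 + α 1 • unitIndex 1 + α 0 • unitIndex 0 = α := by
    funext i; fin_cases i <;> simp [unitIndex]
  have h0 : α = 0 ↔ α 0 = 0 ∧ α 1 = 0 ∧ α 2 = 0 := by
    rw [funext_iff, Fin.forall_fin_succ, Fin.forall_fin_succ, Fin.forall_fin_succ]; simp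
  simp only [PointField.prolongCoeff, iterTotalDeriv, diagonalField_characteristic,
    totalDeriv_iterate_affineChar, hα, diagonalField_base, affineChar, Fin.sum_univ_three, h0]
  split_ifs <;> first | (exfalso; tauto) | ring

/-! ### The equation and the prolonged action in jet coordinates -/

theorem hasDerivAt_comp_jet {I : Set ℝ} (hI : IsOpen I) {φ : ℝ → ℝ} (hφ : ContDiffOn ℝ ∞ φ I)
    {z v : (Fin 3 → ℕ) → ℝ} (hz : z 0 ∈ I) :
    HasDerivAt (fun s : ℝ => φ ((z + s • v) 0)) (deriv φ (z 0) * v 0) 0 := by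
  have h : HasDerivAt φ (deriv φ (z 0)) ((z + (0 : ℝ) • v) 0) := by
    simpa using ((hφ.contDiffAt (hI.mem_nhds hz)).differentiableAt (by simp)).hasDerivAt
  exact h.comp (0 : ℝ) (hasDerivAt_jet_coord z v 0)

theorem eventually_jet_mem {I : Set ℝ} (hI : IsOpen I) {z v : (Fin 3 → ℕ) → ℝ} (hz : z 0 ∈ I) :
    ∀ᶠ s : ℝ in nhds 0, (z + s • v) 0 ∈ I :=
  (hasDerivAt_jet_coord z v 0).continuousAt.eventually (hI.mem_nhds (by simpa using hz))

theorem contDiffOn_deriv {I : Set ℝ} (hI : IsOpen I) {φ : ℝ → ℝ} (hφ : ContDiffOn ℝ ∞ φ I) :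
    ContDiffOn ℝ ∞ (deriv φ) I :=
  hφ.deriv_of_isOpen hI (by simp)

/-- The second total derivative `D_i² (u_β φ(u))`. -/
theorem totalDeriv_totalDeriv_mul_comp {I : Set ℝ} (hI : IsOpen I) {φ : ℝ → ℝ}
    (hφ : ContDiffOn ℝ ∞ φ I) (β : Fin 3 → ℕ) (i : Fin 3) {z : Jet} (hz : z.2 0 ∈ I) :
    totalDeriv i (totalDeriv i fun w => w.2 β * φ (w.2 0)) z =
      z.2 (β + unitIndex i + unitIndex i) * φ (z.2 0)
      + 2 * z.2 (β + unitIndex i) * (deriv φ (z.2 0) * z.2 (unitIndex i))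
      + z.2 β * (deriv (deriv φ) (z.2 0) * z.2 (unitIndex i) ^ 2
        + deriv φ (z.2 0) * z.2 (unitIndex i + unitIndex i)) := by
  have first : ∀ w : Jet, w.2 0 ∈ I → totalDeriv i (fun w => w.2 β * φ (w.2 0)) w =
      w.2 (β + unitIndex i) * φ (w.2 0) + w.2 β * (deriv φ (w.2 0) * w.2 (unitIndex i)) := by
    intro w hw
    refine HasDerivAt.deriv ?_
    exact ((hasDerivAt_jet_coord w.2 (fun α => w.2 (α + unitIndex i)) β).mul
      (hasDerivAt_comp_jet hI hφ (v := fun α => w.2 (α + unitIndex i)) hw)).congr_deriv (by simp)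
  set v : (Fin 3 → ℕ) → ℝ := fun α => z.2 (α + unitIndex i) with hv
  have second : totalDeriv i (totalDeriv i fun w => w.2 β * φ (w.2 0)) z =
      deriv (fun s : ℝ => (z.2 + s • v) (β + unitIndex i) * φ ((z.2 + s • v) 0)
        + (z.2 + s • v) β * (deriv φ ((z.2 + s • v) 0) * (z.2 + s • v) (unitIndex i))) 0 := by
    -- The formula for the first total derivative is available only over `I`; as `I` is open, this
    -- covers all small `s`.
    refine Filter.EventuallyEq.deriv_eq ?_
    filter_upwards [eventually_jet_mem hI (v := v) hz] with s hs
    exact first _ hs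
  rw [second]
  refine HasDerivAt.deriv ?_
  have c := fun α => hasDerivAt_jet_coord z.2 v α
  refine (((c _).mul (hasDerivAt_comp_jet hI hφ hz)).add ((c _).mul
    ((hasDerivAt_comp_jet hI (contDiffOn_deriv hI hφ) hz).mul (c _)))).congr_deriv ?_
  simp only [hv, zero_smul, add_zero, zero_add, Pi.mul_apply]
  ring

/-- The mixed total derivative `D_t D_x g(u)`. -/
theorem totalDeriv_totalDeriv_comp {I : Set ℝ} (hI : IsOpen I) {g : ℝ → ℝ}
    (hg : ContDiffOn ℝ ∞ g I) (i j : Fin 3) {z : Jet} (hz : z.2 0 ∈ I) :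
    totalDeriv i (totalDeriv j fun w => g (w.2 0)) z =
      deriv (deriv g) (z.2 0) * z.2 (unitIndex i) * z.2 (unitIndex j)
      + deriv g (z.2 0) * z.2 (unitIndex j + unitIndex i) := by
  have first : ∀ w : Jet, w.2 0 ∈ I → totalDeriv j (fun w => g (w.2 0)) w =
      deriv g (w.2 0) * w.2 (unitIndex j) := by
    intro w hw
    refine HasDerivAt.deriv ?_
    simpa using hasDerivAt_comp_jet hI hg (v := fun α => w.2 (α + unitIndex j)) hw
  set v : (Fin 3 → ℕ) → ℝ := fun α => z.2 (α + unitIndex i) with hv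
  have second : totalDeriv i (totalDeriv j fun w => g (w.2 0)) z =
      deriv (fun s : ℝ => deriv g ((z.2 + s • v) 0) * (z.2 + s • v) (unitIndex j)) 0 := by
    refine Filter.EventuallyEq.deriv_eq ?_
    filter_upwards [eventually_jet_mem hI (v := v) hz] with s hs
    exact first _ hs
  rw [second]
  refine HasDerivAt.deriv ?_
  refine ((hasDerivAt_comp_jet hI (contDiffOn_deriv hI hg) hz).mul
    (hasDerivAt_jet_coord z.2 v _)).congr_deriv ?_
  simp only [hv, zero_smul, add_zero, zero_add]

/-- The left-hand side of the equation in terms of `φ = 1 / f`, written out. -/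
theorem zoomeron_eq {I : Set ℝ} (hI : IsOpen I) {f g : ℝ → ℝ}
    (hφ : ContDiffOn ℝ ∞ (fun u => (f u)⁻¹) I) (hg : ContDiffOn ℝ ∞ g I) {z : Jet}
    (hz : z.2 0 ∈ I) {φ : ℝ → ℝ} (hφf : φ = fun u => (f u)⁻¹) :
    zoomeron f g z =
      (z.2 ![2, 1, 1] - z.2 ![0, 3, 1]) * φ (z.2 0)
      + 2 * (z.2 ![1, 1, 1] * z.2 ![1, 0, 0] - z.2 ![0, 2, 1] * z.2 ![0, 1, 0]) * deriv φ (z.2 0)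
      + z.2 ![0, 1, 1] * (z.2 ![1, 0, 0] ^ 2 - z.2 ![0, 1, 0] ^ 2) * deriv (deriv φ) (z.2 0)
      + z.2 ![0, 1, 1] * (z.2 ![2, 0, 0] - z.2 ![0, 2, 0]) * deriv φ (z.2 0)
      + 2 * (deriv (deriv g) (z.2 0) * z.2 ![1, 0, 0] * z.2 ![0, 1, 0]
        + deriv g (z.2 0) * z.2 ![1, 1, 0]) := by
  rw [← hφf] at hφ
  have e : (fun w : Jet => w.2 ![0, 1, 1] / f (w.2 0)) = fun w => w.2 ![0, 1, 1] * φ (w.2 0) := by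
    simp [hφf, div_eq_mul_inv]
  have a1 : unitIndex 0 = ![1, 0, 0] := by ext i; fin_cases i <;> rfl
  have a2 : unitIndex 1 = ![0, 1, 0] := by ext i; fin_cases i <;> rfl
  rw [zoomeron, e, totalDeriv_totalDeriv_mul_comp hI hφ _ _ hz,
    totalDeriv_totalDeriv_mul_comp hI hφ _ _ hz, totalDeriv_totalDeriv_comp hI hg _ _ hz, a1, a2]
  simp only [Matrix.cons_add_cons, Matrix.empty_add_empty, Nat.reduceAdd, add_zero, zero_add]
  ring

/-- The action of a prolonged diagonal vector field on the left-hand side of the equation. -/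
theorem diagonalField_prolong_zoomeron {I : Set ℝ} (hI : IsOpen I) {f g : ℝ → ℝ}
    (hφ : ContDiffOn ℝ ∞ (fun u => (f u)⁻¹) I) (hg : ContDiffOn ℝ ∞ g I) {z : Jet}
    (hz : z.2 0 ∈ I) {φ : ℝ → ℝ} (hφf : φ = fun u => (f u)⁻¹) (c m : Fin 3 → ℝ) (n γ : ℝ)
    (hm : m 1 = m 0) :
    (diagonalField c m n γ).prolong (zoomeron f g) z =
      (z.2 ![2, 1, 1] - z.2 ![0, 3, 1]) * ((n - 3 * m 0 - m 2) * φ (z.2 0)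
        + deriv φ (z.2 0) * (n * z.2 0 + γ))
      + 2 * (z.2 ![1, 1, 1] * z.2 ![1, 0, 0] - z.2 ![0, 2, 1] * z.2 ![0, 1, 0]) *
        ((2 * n - 3 * m 0 - m 2) * deriv φ (z.2 0) + deriv (deriv φ) (z.2 0) * (n * z.2 0 + γ))
      + z.2 ![0, 1, 1] * (z.2 ![1, 0, 0] ^ 2 - z.2 ![0, 1, 0] ^ 2) *
        ((3 * n - 3 * m 0 - m 2) * deriv (deriv φ) (z.2 0)
          + deriv (deriv (deriv φ)) (z.2 0) * (n * z.2 0 + γ))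
      + z.2 ![0, 1, 1] * (z.2 ![2, 0, 0] - z.2 ![0, 2, 0]) *
        ((2 * n - 3 * m 0 - m 2) * deriv φ (z.2 0) + deriv (deriv φ) (z.2 0) * (n * z.2 0 + γ))
      + 2 * (((2 * n - 2 * m 0) * deriv (deriv g) (z.2 0)
          + deriv (deriv (deriv g)) (z.2 0) * (n * z.2 0 + γ)) * z.2 ![1, 0, 0] * z.2 ![0, 1, 0]
        + ((n - 2 * m 0) * deriv g (z.2 0) + deriv (deriv g) (z.2 0) * (n * z.2 0 + γ))
          * z.2 ![1, 1, 0]) := by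
  have hφ' := hφ
  rw [← hφf] at hφ'
  set X := diagonalField c m n γ with hX
  set v := X.prolongCoeff z with hv
  have step : X.prolong (zoomeron f g) z = deriv (fun s : ℝ =>
      ((z.2 + s • v) ![2, 1, 1] - (z.2 + s • v) ![0, 3, 1]) * φ ((z.2 + s • v) 0)
      + 2 * ((z.2 + s • v) ![1, 1, 1] * (z.2 + s • v) ![1, 0, 0]
        - (z.2 + s • v) ![0, 2, 1] * (z.2 + s • v) ![0, 1, 0]) * deriv φ ((z.2 + s • v) 0)
      + (z.2 + s • v) ![0, 1, 1] * ((z.2 + s • v) ![1, 0, 0] ^ 2 - (z.2 + s • v) ![0, 1, 0] ^ 2)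
        * deriv (deriv φ) ((z.2 + s • v) 0)
      + (z.2 + s • v) ![0, 1, 1] * ((z.2 + s • v) ![2, 0, 0] - (z.2 + s • v) ![0, 2, 0])
        * deriv φ ((z.2 + s • v) 0)
      + 2 * (deriv (deriv g) ((z.2 + s • v) 0) * (z.2 + s • v) ![1, 0, 0]
        * (z.2 + s • v) ![0, 1, 0]
        + deriv g ((z.2 + s • v) 0) * (z.2 + s • v) ![1, 1, 0])) 0 := by
    refine Filter.EventuallyEq.deriv_eq ?_
    filter_upwards [eventually_jet_mem hI (v := v) hz] with s hs
    exact zoomeron_eq hI hφ hg (z := (z.1 + s • X.base z, z.2 + s • v)) hs hφf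
  rw [step]
  refine HasDerivAt.deriv ?_
  have k := fun α => hasDerivAt_jet_coord z.2 v α
  have d1 := contDiffOn_deriv hI hφ'
  have d2 := contDiffOn_deriv hI d1
  have e1 := contDiffOn_deriv hI hg
  have e2 := contDiffOn_deriv hI e1
  have p0 := hasDerivAt_comp_jet hI hφ' (v := v) hz
  have p1 := hasDerivAt_comp_jet hI d1 (v := v) hz
  have p2 := hasDerivAt_comp_jet hI d2 (v := v) hz
  have q1 := hasDerivAt_comp_jet hI e1 (v := v) hz
  have q2 := hasDerivAt_comp_jet hI e2 (v := v) hz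
  refine (((((((k _).sub (k _)).mul p0).add
    (((((k _).mul (k _)).sub ((k _).mul (k _))).const_mul 2).mul p1)).add
    (((k _).mul (((k _).pow 2).sub ((k _).pow 2))).mul p2)).add
    (((k _).mul ((k _).sub (k _))).mul p1)).add
    ((((q2.mul (k _)).mul (k _)).add (q1.mul (k _))).const_mul 2)).congr_deriv ?_
  -- Since `m 1 = m 0`, orders in `t` and `x` count alike; this keeps the differences of `t`- and
  -- `x`-terms in `H` together.
  have w : ∀ a b d : ℕ, v ![a, b, d] = (n - (a * m 0 + b * m 0 + d * m 2)) * z.2 ![a, b, d]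
      + if ![a, b, d] = 0 then γ else 0 := by
    intro a b d
    rw [hv, hX, diagonalField_prolongCoeff]
    simp [Fin.sum_univ_three, hm]
  have w0 : v 0 = n * z.2 0 + γ := by
    rw [hv, hX, diagonalField_prolongCoeff]; simp
  simp only [w, w0, zero_smul, add_zero, Matrix.cons_eq_zero_iff]
  norm_num
  ring

/-! ### Sufficiency of the determining equations -/

theorem Admissible.smooth_inv {I : Set ℝ} {f g : ℝ → ℝ} (h : Admissible I f g) :
    ContDiffOn ℝ ∞ (fun u => (f u)⁻¹) I :=
  h.smooth_f.inv h.f_ne_zero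

/-- Differentiation of an identity `ψ' η + j ψ = κ ψ + a`, where `η = n u + γ`. -/
theorem deriv_weight_identity {I : Set ℝ} (hI : IsOpen I) {ψ : ℝ → ℝ} (hψ : ContDiffOn ℝ ∞ ψ I)
    {n γ j κ a : ℝ} (h : ∀ u ∈ I, deriv ψ u * (n * u + γ) + j * ψ u = κ * ψ u + a) :
    ∀ u ∈ I, deriv (deriv ψ) u * (n * u + γ) + (j + n) * deriv ψ u = κ * deriv ψ u := by
  intro u hu
  have d0 : HasDerivAt ψ (deriv ψ u) u :=
    ((hψ.contDiffAt (hI.mem_nhds hu)).differentiableAt (by simp)).hasDerivAt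
  have d1 : HasDerivAt (deriv ψ) (deriv (deriv ψ) u) u :=
    (((contDiffOn_deriv hI hψ).contDiffAt (hI.mem_nhds hu)).differentiableAt (by simp)).hasDerivAt
  have l := (d1.mul (((hasDerivAt_id u).const_mul n).add_const γ)).add (d0.const_mul j)
  have r := (d0.const_mul κ).add_const a
  have e := l.unique (r.congr_of_eventuallyEq (by
    filter_upwards [hI.mem_nhds hu] with w hw using h w hw))
  simp only [id, mul_one] at e
  linarith

theorem contDiff_diagonalField (c m : Fin 3 → ℝ) (n γ : ℝ) :
    ContDiff ℝ ∞ (diagonalField c m n γ) := by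
  rw [contDiff_pi]
  intro i
  fin_cases i <;> simp [diagonalField] <;> fun_prop

/-- A sufficient condition for a diagonal vector field to be a symmetry. -/
theorem isLieSymmetry_diagonalField {I : Set ℝ} {f g : ℝ → ℝ} (h : Admissible I f g)
    {c m : Fin 3 → ℝ} {n γ κ : ℝ} (hm : m 1 = m 0)
    (hf : ∀ u ∈ I, deriv (fun u => (f u)⁻¹) u * (n * u + γ) = κ * (f u)⁻¹)
    (hg : ∀ u ∈ I, deriv (deriv g) u * (n * u + γ) + n * deriv g u
      = (n - m 0 - m 2 + κ) * deriv g u) :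
    IsLieSymmetry I f g (diagonalField c m n γ) := by
  refine ⟨(contDiff_diagonalField c m n γ).contDiffOn, fun z hz hH => ?_⟩
  rw [zoomeron_eq h.isOpen h.smooth_inv h.smooth_g hz rfl] at hH
  rw [diagonalField_prolong_zoomeron h.isOpen h.smooth_inv h.smooth_g hz rfl c m n γ hm]
  -- Each differentiation adds one `n` to the coefficient `j`, which matches the extra factor of a
  -- first derivative of `u` in the corresponding term of `H`.
  have f1 := deriv_weight_identity h.isOpen h.smooth_inv (j := 0) (a := 0) (by simpa using hf)
  have f2 := deriv_weight_identity h.isOpen (contDiffOn_deriv h.isOpen h.smooth_inv) (a := 0)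
    (by simpa using f1)
  have g2 := deriv_weight_identity h.isOpen (contDiffOn_deriv h.isOpen h.smooth_g) (a := 0)
    (by simpa using hg)
  replace hf := hf _ hz
  replace hg := hg _ hz
  replace f1 := f1 _ hz
  replace f2 := f2 _ hz
  replace g2 := g2 _ hz
  generalize deriv (deriv (deriv fun u => (f u)⁻¹)) (z.2 0) = φ3 at *
  generalize deriv (deriv fun u => (f u)⁻¹) (z.2 0) = φ2 at *
  generalize deriv (fun u => (f u)⁻¹) (z.2 0) = φ1 at *
  generalize (f (z.2 0))⁻¹ = φ0 at *
  generalize deriv (deriv (deriv g)) (z.2 0) = g3 at *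
  generalize deriv (deriv g) (z.2 0) = g2' at *
  generalize deriv g (z.2 0) = g1 at *
  -- The multiple of `hH` is the common weight of all terms of `H`; the other summands are the
  -- determining equations times the jet monomials they accompany.
  linear_combination (n - 3 * m 0 - m 2 + κ) * hH
    + (z.2 ![2, 1, 1] - z.2 ![0, 3, 1]) * hf
    + (2 * (z.2 ![1, 1, 1] * z.2 ![1, 0, 0] - z.2 ![0, 2, 1] * z.2 ![0, 1, 0])
      + z.2 ![0, 1, 1] * (z.2 ![2, 0, 0] - z.2 ![0, 2, 0])) * f1
    + z.2 ![0, 1, 1] * (z.2 ![1, 0, 0] ^ 2 - z.2 ![0, 1, 0] ^ 2) * f2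
    + 2 * z.2 ![1, 0, 0] * z.2 ![0, 1, 0] * g2 + 2 * z.2 ![1, 1, 0] * hg

/-! ### Linear independence and commutators -/

/-- The vector field `y ∂_y + (n u + γ) ∂_u`. -/
def affineField (n γ : ℝ) : PointField := diagonalField 0 ![0, 0, 1] n γ

theorem scalingField_eq (β : ℝ) : scalingField β = affineField β 0 := by
  funext p i; fin_cases i <;> simp [scalingField, affineField, diagonalField]

theorem translationField_eq (γ : ℝ) : translationField γ = affineField 0 γ := by
  funext p i; fin_cases i <;> simp [translationField, affineField, diagonalField]

theorem Y₁_eq : Y₁ = diagonalField ![1, 0, 0] 0 0 0 := by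
  funext p i; fin_cases i <;> simp [Y₁, diagonalField]

theorem Y₂_eq : Y₂ = diagonalField ![0, 1, 0] 0 0 0 := by
  funext p i; fin_cases i <;> simp [Y₂, diagonalField]

theorem Y₃_eq : Y₃ = diagonalField ![0, 0, 1] 0 0 0 := by
  funext p i; fin_cases i <;> simp [Y₃, diagonalField]

theorem Y₄_eq : Y₄ = diagonalField 0 ![1, 1, -1] 0 0 := by
  funext p i; fin_cases i <;> simp [Y₄, diagonalField]

theorem combination_eq (a b c d e n γ : ℝ) :
    a • Y₁ + (b • Y₂ + (c • Y₃ + (d • Y₄ + e • affineField n γ))) =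
      diagonalField ![a, b, c] ![d, d, e - d] (e * n) (e * γ) := by
  funext p i
  fin_cases i <;> simp [Y₁, Y₂, Y₃, Y₄, affineField, diagonalField] <;> ring

theorem combination_eq_zero {a b c d e n γ : ℝ}
    (h : a • Y₁ + (b • Y₂ + (c • Y₃ + (d • Y₄ + e • affineField n γ))) = 0) :
    a = 0 ∧ b = 0 ∧ c = 0 ∧ d = 0 ∧ e = 0 := by
  rw [combination_eq] at h
  -- Evaluation at the origin isolates the translations, and at the point with all coordinates `1`
  -- the scalings.
  have h0 := congrFun h 0
  have h1 := congrFun h 1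
  have a0 := congrFun h0 0
  have a1 := congrFun h0 1
  have a2 := congrFun h0 2
  have b0 := congrFun h1 0
  have b2 := congrFun h1 2
  simp [diagonalField] at a0 a1 a2 b0 b2
  refine ⟨a0, a1, a2, ?_, ?_⟩ <;> linarith

theorem linearIndependent_with_affineField (n γ : ℝ) :
    LinearIndependent ℝ ![Y₁, Y₂, Y₃, Y₄, affineField n γ] := by
  rw [Fintype.linearIndependent_iff]
  intro c h
  simp only [Fin.sum_univ_succ, Fin.sum_univ_zero, add_zero] at h
  obtain ⟨h0, h1, h2, h3, h4⟩ := combination_eq_zero (n := n) (γ := γ) h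
  intro i
  fin_cases i <;> assumption

theorem linearIndependent_basicFields : LinearIndependent ℝ ![Y₁, Y₂, Y₃, Y₄] := by
  have := (linearIndependent_with_affineField 0 0).comp Fin.castSucc (Fin.castSucc_injective _)
  convert this using 1
  funext i; fin_cases i <;> rfl

/-- The commutator of two diagonal vector fields. -/
theorem bracket_diagonalField (c m : Fin 3 → ℝ) (n γ : ℝ) (c' m' : Fin 3 → ℝ) (n' γ' : ℝ) :
    bracket (diagonalField c m n γ) (diagonalField c' m' n' γ') =
      diagonalField (fun i => m' i * c i - m i * c' i) 0 0 (n' * γ - n * γ') := by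
  have key : ∀ (c m : Fin 3 → ℝ) (n γ : ℝ) (p v : Fin 4 → ℝ),
      fderiv ℝ (diagonalField c m n γ) p v = ![m 0 * v 0, m 1 * v 1, m 2 * v 2, n * v 3] := by
    intro c m n γ p v
    have hd := ((contDiff_diagonalField c m n γ).differentiable (by simp) p).hasFDerivAt
    have hl := hd.hasLineDerivAt v
    refine HasDerivAt.unique hl ?_
    rw [hasDerivAt_pi]
    have q : ∀ i, HasDerivAt (fun s : ℝ => (p + s • v) i) (v i) 0 := fun i => by
      simpa using ((hasDerivAt_id (0 : ℝ)).mul_const (v i)).const_add (p i)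
    intro i
    fin_cases i
    exacts [((q 0).const_mul (m 0)).const_add (c 0), ((q 1).const_mul (m 1)).const_add (c 1),
      ((q 2).const_mul (m 2)).const_add (c 2), ((q 3).const_mul n).add_const γ]
  funext p i
  simp only [bracket, VectorField.lieBracket, key, Pi.sub_apply]
  fin_cases i <;> simp [diagonalField] <;> ring

theorem diagonalField_zero : diagonalField 0 0 0 0 = 0 := by
  funext p i; fin_cases i <;> simp [diagonalField]

theorem bracket_Y₁_Y₂ : bracket Y₁ Y₂ = 0 := by
  rw [Y₁_eq, Y₂_eq, bracket_diagonalField, ← diagonalField_zero]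
  congr 1 <;> [skip; simp]
  funext i; simp

theorem bracket_Y₁_Y₃ : bracket Y₁ Y₃ = 0 := by
  rw [Y₁_eq, Y₃_eq, bracket_diagonalField, ← diagonalField_zero]
  congr 1 <;> [skip; simp]
  funext i; simp

theorem bracket_Y₂_Y₃ : bracket Y₂ Y₃ = 0 := by
  rw [Y₂_eq, Y₃_eq, bracket_diagonalField, ← diagonalField_zero]
  congr 1 <;> [skip; simp]
  funext i; simp

theorem bracket_Y₁_Y₄ : bracket Y₁ Y₄ = Y₁ := by
  rw [Y₁_eq, Y₄_eq, bracket_diagonalField]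
  congr 1 <;> [skip; simp]
  funext i; fin_cases i <;> simp

theorem bracket_Y₂_Y₄ : bracket Y₂ Y₄ = Y₂ := by
  rw [Y₂_eq, Y₄_eq, bracket_diagonalField]
  congr 1 <;> [skip; simp]
  funext i; fin_cases i <;> simp

theorem bracket_Y₃_Y₄ : bracket Y₃ Y₄ = -Y₃ := by
  rw [Y₃_eq, Y₄_eq, bracket_diagonalField]
  funext p i; fin_cases i <;> simp [diagonalField]

theorem bracket_Y₁_affineField (n γ : ℝ) : bracket Y₁ (affineField n γ) = 0 := by
  rw [Y₁_eq, affineField, bracket_diagonalField]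
  funext p i; fin_cases i <;> simp [diagonalField]

theorem bracket_Y₂_affineField (n γ : ℝ) : bracket Y₂ (affineField n γ) = 0 := by
  rw [Y₂_eq, affineField, bracket_diagonalField]
  funext p i; fin_cases i <;> simp [diagonalField]

theorem bracket_Y₃_affineField (n γ : ℝ) : bracket Y₃ (affineField n γ) = Y₃ := by
  rw [Y₃_eq, affineField, bracket_diagonalField]
  funext p i; fin_cases i <;> simp [diagonalField]

theorem bracket_Y₄_affineField (n γ : ℝ) : bracket Y₄ (affineField n γ) = 0 := by
  rw [Y₄_eq, affineField, bracket_diagonalField]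
  funext p i; fin_cases i <;> simp [diagonalField]

theorem contDiff_Y₁ : ContDiff ℝ ∞ Y₁ := Y₁_eq ▸ contDiff_diagonalField _ _ _ _

theorem contDiff_Y₂ : ContDiff ℝ ∞ Y₂ := Y₂_eq ▸ contDiff_diagonalField _ _ _ _

theorem contDiff_Y₃ : ContDiff ℝ ∞ Y₃ := Y₃_eq ▸ contDiff_diagonalField _ _ _ _

theorem contDiff_Y₄ : ContDiff ℝ ∞ Y₄ := Y₄_eq ▸ contDiff_diagonalField _ _ _ _

/-- `Y₃` has eigenvalue `-1`, so it has to be `e₂`: the normal form requires `a ≤ b`. -/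
theorem isA45_basicFields : IsA45 (-1) 1 (Submodule.span ℝ {Y₁, Y₂, Y₃, Y₄}) := by
  refine ⟨by norm_num, le_rfl, by norm_num, le_rfl, Y₁, Y₃, Y₂, Y₄, contDiff_Y₁, contDiff_Y₃,
    contDiff_Y₂, contDiff_Y₄, ?_, ?_, bracket_Y₁_Y₃, bracket_Y₁_Y₂, ?_, bracket_Y₁_Y₄, ?_, ?_⟩
  · have := linearIndependent_basicFields.comp ![0, 2, 1, 3] (by decide)
    convert this using 1
    funext i; fin_cases i <;> rfl
  · rw [Set.insert_comm Y₃ Y₂]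
  · funext p
    have h : VectorField.lieBracket ℝ Y₂ Y₃ p = 0 := congrFun bracket_Y₂_Y₃ p
    rw [bracket, VectorField.lieBracket_swap, h, neg_zero, Pi.zero_apply]
  · rw [bracket_Y₃_Y₄, neg_one_smul]
  · rw [bracket_Y₂_Y₄, one_smul]

/-! ### Invariance under the spans -/

theorem isLieSymmetry_of_mem_span_basicFields {I : Set ℝ} {f g : ℝ → ℝ} (h : Admissible I f g)
    {X : PointField} (hX : X ∈ Submodule.span ℝ {Y₁, Y₂, Y₃, Y₄}) : IsLieSymmetry I f g X := by
  simp only [Submodule.mem_span_insert, Submodule.mem_span_singleton] at hX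
  obtain ⟨a, _, ⟨b, _, ⟨c, _, ⟨d, rfl⟩, rfl⟩, rfl⟩, rfl⟩ := hX
  have e := combination_eq a b c d 0 0 0
  rw [zero_smul, add_zero] at e
  rw [e]
  exact isLieSymmetry_diagonalField h (κ := 0) rfl (by simp) (by simp)

/-- The determining equations are sufficient. -/
theorem isAdditionalSymmetry_affineField {I : Set ℝ} {f g : ℝ → ℝ} (h : Admissible I f g)
    {n γ κ a : ℝ} (hf : ∀ u ∈ I, deriv (fun u => (f u)⁻¹) u * (n * u + γ) = κ * (f u)⁻¹)
    (hg : ∀ u ∈ I, deriv g u * (n * u + γ) = (n - 1 + κ) * g u + a) :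
    IsAdditionalSymmetry I f g (affineField n γ) := by
  refine ⟨linearIndependent_with_affineField n γ, ?_, bracket_Y₁_affineField n γ,
    bracket_Y₂_affineField n γ, bracket_Y₃_affineField n γ, bracket_Y₄_affineField n γ,
    Y₁, Y₂, Y₃, Y₄, affineField n γ, contDiff_Y₁, contDiff_Y₂, contDiff_Y₃, contDiff_Y₄,
    contDiff_diagonalField _ _ _ _, linearIndependent_with_affineField n γ, rfl, bracket_Y₁_Y₂,
    bracket_Y₁_Y₃, bracket_Y₂_Y₃, bracket_Y₄_affineField n γ, ?_⟩
  · intro X hX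
    simp only [Submodule.mem_span_insert, Submodule.mem_span_singleton] at hX
    obtain ⟨a, _, ⟨b, _, ⟨c, _, ⟨d, _, ⟨e, rfl⟩, rfl⟩, rfl⟩, rfl⟩, rfl⟩ := hX
    rw [combination_eq]
    have hg' := deriv_weight_identity h.isOpen h.smooth_g (j := 0) (by simpa using hg)
    -- The coefficient `d` of `Y₄` drops out of `m 0 + m 2 = d + (e - d)`, so both equations are `e`
    -- times those for the fifth field.
    refine isLieSymmetry_diagonalField h (κ := e * κ) rfl (fun u hu => ?_) (fun u hu => ?_)
    · linear_combination e * hf u hu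
    · simp only [Matrix.cons_val]
      linear_combination e * hg' u hu
  · have m1 : Y₁ ∈ Submodule.span ℝ {Y₁, Y₂, Y₃} := Submodule.subset_span (by simp)
    have m2 : Y₂ ∈ Submodule.span ℝ {Y₁, Y₂, Y₃} := Submodule.subset_span (by simp)
    have m3 : Y₃ ∈ Submodule.span ℝ {Y₁, Y₂, Y₃} := Submodule.subset_span (by simp)
    rintro X (rfl | rfl | rfl) Y (rfl | rfl)
    · rwa [bracket_Y₁_Y₄]
    · rw [bracket_Y₁_affineField]; exact zero_mem _
    · rwa [bracket_Y₂_Y₄]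
    · rw [bracket_Y₂_affineField]; exact zero_mem _
    · rw [bracket_Y₃_Y₄]; exact neg_mem m3
    · rwa [bracket_Y₃_affineField]

/-! ### Necessity of the determining equations -/

/-- A jet over `u` in which, besides `u`, only `u_t`, `u_tx`, `u_txy` and `u_ttxy` may be nonzero. -/
def sparseJet (u p q r s : ℝ) : Jet :=
  (0, fun α => if α = 0 then u else if α = ![1, 0, 0] then p else if α = ![1, 1, 0] then q
    else if α = ![1, 1, 1] then r else if α = ![2, 1, 1] then s else 0)

/-- On the sparse jets `H` reduces to `s φ + 2 r p φ' + 2 q g'`, which can be made zero by solving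
for `s`, since `φ` has no zero. -/
theorem determining_equations {I : Set ℝ} {f g : ℝ → ℝ} (h : Admissible I f g) {n γ : ℝ}
    (hX : IsLieSymmetry I f g (affineField n γ)) :
    ∃ κ : ℝ, (∀ u ∈ I, deriv (fun u => (f u)⁻¹) u * (n * u + γ) = κ * (f u)⁻¹) ∧
      ∀ u ∈ I, deriv (deriv g) u * (n * u + γ) + n * deriv g u = (n - 1 + κ) * deriv g u := by
  set φ : ℝ → ℝ := fun u => (f u)⁻¹ with hφ
  have hφI : ContDiffOn ℝ ∞ φ I := h.smooth_inv
  have φ0 : ∀ u ∈ I, φ u ≠ 0 := fun u hu => inv_ne_zero (h.f_ne_zero u hu)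
  have key : ∀ u ∈ I, ∀ p q r s : ℝ,
      s * φ u + 2 * (r * p) * deriv φ u + 2 * (deriv g u * q) = 0 →
      s * ((n - 1) * φ u + deriv φ u * (n * u + γ))
      + 2 * (r * p) * ((2 * n - 1) * deriv φ u + deriv (deriv φ) u * (n * u + γ))
      + 2 * ((n * deriv g u + deriv (deriv g) u * (n * u + γ)) * q) = 0 := by
    intro u hu p q r s H
    have v0 : (sparseJet u p q r s).2 0 = u := by simp [sparseJet]
    have hz : (sparseJet u p q r s).2 0 ∈ I := by rwa [v0]
    have vals : (sparseJet u p q r s).2 ![1, 0, 0] = p ∧ (sparseJet u p q r s).2 ![1, 1, 0] = q ∧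
        (sparseJet u p q r s).2 ![1, 1, 1] = r ∧ (sparseJet u p q r s).2 ![2, 1, 1] = s ∧
        (sparseJet u p q r s).2 ![0, 3, 1] = 0 ∧ (sparseJet u p q r s).2 ![0, 2, 1] = 0 ∧
        (sparseJet u p q r s).2 ![0, 1, 0] = 0 ∧ (sparseJet u p q r s).2 ![0, 1, 1] = 0 := by
      simp [sparseJet]
    obtain ⟨v1, v2, v3, v4, v5, v6, v7, v8⟩ := vals
    have := hX.2 (sparseJet u p q r s) hz (by
      rw [zoomeron_eq h.isOpen h.smooth_inv h.smooth_g hz hφ, v0, v1, v2, v3, v4, v5, v6, v7, v8]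
      linear_combination H)
    rw [affineField, diagonalField_prolong_zoomeron h.isOpen h.smooth_inv h.smooth_g hz hφ _ _ _ _
      rfl, v0, v1, v2, v3, v4, v5, v6, v7, v8] at this
    simp only [Matrix.cons_val] at this
    linear_combination this
  have ode : ∀ u ∈ I, (deriv (deriv φ) u * (n * u + γ) + n * deriv φ u) * φ u
      - deriv φ u * (n * u + γ) * deriv φ u = 0 := by
    intro u hu
    -- With `q = 0` the function `g` is absent; the result is the numerator of `(φ' η / φ)'`.
    have := key u hu 1 0 (φ u) (-2 * deriv φ u) (by ring)
    linear_combination this / 2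
  have hd : ∀ u ∈ I, HasDerivAt (fun u => deriv φ u * (n * u + γ) / φ u) 0 u := by
    intro u hu
    have d0 : HasDerivAt φ (deriv φ u) u :=
      ((hφI.contDiffAt (h.isOpen.mem_nhds hu)).differentiableAt (by simp)).hasDerivAt
    have d1 : HasDerivAt (deriv φ) (deriv (deriv φ) u) u :=
      (((contDiffOn_deriv h.isOpen hφI).contDiffAt (h.isOpen.mem_nhds hu)).differentiableAt
        (by simp)).hasDerivAt
    refine ((d1.mul (((hasDerivAt_id u).const_mul n).add_const γ)).div d0
      (φ0 u hu)).congr_deriv ?_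
    rw [div_eq_zero_iff]
    left
    simp only [Pi.mul_apply, id]
    linear_combination ode u hu
  obtain ⟨κ, hκ⟩ := h.isOpen.exists_is_const_of_deriv_eq_zero h.isPreconnected
    (fun u hu => (hd u hu).differentiableAt.differentiableWithinAt) (fun u hu => (hd u hu).deriv)
  have e1 : ∀ u ∈ I, deriv φ u * (n * u + γ) = κ * φ u := fun u hu => by
    rw [← hκ u hu, div_mul_cancel₀ _ (φ0 u hu)]
  refine ⟨κ, e1, fun u hu => ?_⟩
  -- With `p = r = 0` only `φ` and `g'` are compared, and `φ' η = κ φ` removes the derivative of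
  -- `φ`.
  have := key u hu 0 (φ u) 0 (-2 * deriv g u) (by ring)
  refine mul_right_cancel₀ (φ0 u hu) ?_
  linear_combination this / 2 + deriv g u * e1 u hu

/-! ### Solving the ordinary differential equations -/

/-- The function `ψ u^(-r)` has zero derivative, hence is constant on the connected set `I`. -/
theorem exists_eq_const_mul_rpow {I : Set ℝ} (hI : IsOpen I) (hI' : IsPreconnected I)
    (hpos : I ⊆ Ioi 0) {ψ : ℝ → ℝ} (hψ : ContDiffOn ℝ ∞ ψ I) {r : ℝ}
    (h : ∀ u ∈ I, deriv ψ u * u = r * ψ u) : ∃ c, ∀ u ∈ I, ψ u = c * u ^ r := by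
  have hd : ∀ u ∈ I, HasDerivAt (fun u => ψ u * u ^ (-r)) 0 u := by
    intro u hu
    have hu0 : 0 < u := hpos hu
    have d0 : HasDerivAt ψ (deriv ψ u) u :=
      ((hψ.contDiffAt (hI.mem_nhds hu)).differentiableAt (by simp)).hasDerivAt
    refine (d0.mul (Real.hasDerivAt_rpow_const (p := -r) (Or.inl hu0.ne'))).congr_deriv ?_
    have e : u ^ (-r) = u * u ^ (-r - 1) := by
      rw [Real.rpow_sub_one hu0.ne', mul_div_cancel₀ _ hu0.ne']
    rw [e]
    linear_combination u ^ (-r - 1) * h u hu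
  obtain ⟨c, hc⟩ := hI.exists_is_const_of_deriv_eq_zero hI'
    (fun u hu => (hd u hu).differentiableAt.differentiableWithinAt) (fun u hu => (hd u hu).deriv)
  refine ⟨c, fun u hu => ?_⟩
  have hu0 : 0 < u := hpos hu
  rw [← hc u hu, mul_assoc, ← Real.rpow_add hu0, neg_add_cancel, Real.rpow_zero, mul_one]

theorem exists_eq_const_mul_exp {I : Set ℝ} (hI : IsOpen I) (hI' : IsPreconnected I)
    {ψ : ℝ → ℝ} (hψ : ContDiffOn ℝ ∞ ψ I) {r : ℝ}
    (h : ∀ u ∈ I, deriv ψ u = r * ψ u) : ∃ c, ∀ u ∈ I, ψ u = c * Real.exp (r * u) := by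
  have hd : ∀ u ∈ I, HasDerivAt (fun u => ψ u * Real.exp (-r * u)) 0 u := by
    intro u hu
    have d0 : HasDerivAt ψ (deriv ψ u) u :=
      ((hψ.contDiffAt (hI.mem_nhds hu)).differentiableAt (by simp)).hasDerivAt
    refine (d0.mul ((hasDerivAt_id u).const_mul (-r)).exp).congr_deriv ?_
    rw [h u hu]
    simp only [id]
    ring
  obtain ⟨c, hc⟩ := hI.exists_is_const_of_deriv_eq_zero hI'
    (fun u hu => (hd u hu).differentiableAt.differentiableWithinAt) (fun u hu => (hd u hu).deriv)
  refine ⟨c, fun u hu => ?_⟩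
  rw [← hc u hu, mul_assoc, ← Real.exp_add, neg_mul, neg_add_cancel, Real.exp_zero, mul_one]

theorem exists_eq_add_of_deriv_eq_hasDerivAt {I : Set ℝ} (hI : IsOpen I) (hI' : IsPreconnected I)
    {g χ χ' : ℝ → ℝ} (hg : ContDiffOn ℝ ∞ g I) (hχ : ∀ u ∈ I, HasDerivAt χ (χ' u) u)
    (h : ∀ u ∈ I, deriv g u = χ' u) : ∃ c, ∀ u ∈ I, g u = c + χ u := by
  obtain ⟨c, hc⟩ := hI.exists_eq_add_of_deriv_eq hI' (hg.differentiableOn (by simp))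
    (fun u hu => (hχ u hu).differentiableAt.differentiableWithinAt)
    (fun u hu => by rw [h u hu, (hχ u hu).deriv])
  exact ⟨c, fun u hu => (hc hu).trans (add_comm _ _)⟩

theorem Admissible.nonempty {I : Set ℝ} {f g : ℝ → ℝ} (h : Admissible I f g) : I.Nonempty := by
  by_contra hne
  rw [not_nonempty_iff_eq_empty] at hne
  exact h.f_nonconstant ⟨0, by simp [hne]⟩

theorem Admissible.exists_deriv_ne_zero {I : Set ℝ} {f g : ℝ → ℝ} (h : Admissible I f g) :
    ∃ u ∈ I, deriv g u ≠ 0 := by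
  by_contra! hd
  obtain ⟨c, hc⟩ := h.isOpen.exists_is_const_of_deriv_eq_zero h.isPreconnected
    (h.smooth_g.differentiableOn (by simp)) (fun u hu => hd u hu)
  exact h.g_nonconstant ⟨c, hc⟩

/-- If `η = n u + γ` vanishes identically, then `y ∂_y + η ∂_u` is not a symmetry. -/
theorem not_isLieSymmetry_affineField_zero {I : Set ℝ} {f g : ℝ → ℝ} (h : Admissible I f g) :
    ¬ IsLieSymmetry I f g (affineField 0 0) := by
  intro hX
  obtain ⟨κ, hf, hg⟩ := determining_equations h hX
  obtain ⟨u, hu, hne⟩ := h.exists_deriv_ne_zero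
  have e1 := hf u hu
  have e2 := hg u hu
  have hκ : κ = 0 := by
    have : κ * (f u)⁻¹ = 0 := by linear_combination -e1
    exact (mul_eq_zero.1 this).resolve_right (inv_ne_zero (h.f_ne_zero u hu))
  apply hne
  rw [hκ] at e2
  linear_combination e2

/-! ### Classification of the functions -/

theorem scalingField_classification {I : Set ℝ} {f g : ℝ → ℝ} {β : ℝ} (hpos : I ⊆ Ioi 0)
    (h : Admissible I f g) (hX : IsLieSymmetry I f g (scalingField β)) :
    ∃ f₀ K g₀ g₁ : ℝ, f₀ ≠ 0 ∧ K ≠ 0 ∧ g₁ ≠ 0 ∧ (∀ u ∈ I, f u = f₀ * u ^ K) ∧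
      ((β ≠ 0 ∧ -(1 / β) - (K - 1) ≠ 0 ∧ ∀ u ∈ I, g u = g₀ + g₁ * u ^ (-(1 / β) - (K - 1))) ∨
        (K ≠ 1 ∧ β = 1 / (1 - K) ∧ ∀ u ∈ I, g u = g₀ + g₁ * Real.log u)) := by
  rw [scalingField_eq] at hX
  have hβ : β ≠ 0 := by
    rintro rfl
    exact not_isLieSymmetry_affineField_zero h hX
  obtain ⟨κ, hf, hg⟩ := determining_equations h hX
  -- `K` is normalized to be the exponent of `f`, so that `1 / f` has exponent `-K`.
  obtain ⟨K, rfl⟩ : ∃ K, κ = -(K * β) := ⟨-κ / β, by field_simp⟩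
  obtain ⟨c, hc⟩ := exists_eq_const_mul_rpow h.isOpen h.isPreconnected hpos h.smooth_inv (r := -K)
    (fun u hu => mul_left_cancel₀ hβ (by linear_combination hf u hu))
  have hf' : ∀ u ∈ I, f u = c⁻¹ * u ^ K := fun u hu => by
    rw [← inv_inv (f u), hc u hu, mul_inv, Real.rpow_neg (le_of_lt (hpos hu)), inv_inv]
  have hc0 : c ≠ 0 := by
    -- As `0⁻¹ = 0`, the value `c = 0` would make `f` vanish.
    rintro rfl
    obtain ⟨u, hu⟩ := h.nonempty
    exact h.f_ne_zero u hu (by simp [hf' u hu])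
  have hK : K ≠ 0 := by
    rintro rfl
    exact h.f_nonconstant ⟨c⁻¹, fun u hu => by simp [hf' u hu]⟩
  set p := -(1 / β) - (K - 1) with hp
  have hpβ : p * β = β - 1 - K * β := by rw [hp]; field_simp; ring
  obtain ⟨d, hd⟩ := exists_eq_const_mul_rpow h.isOpen h.isPreconnected hpos
    (contDiffOn_deriv h.isOpen h.smooth_g) (r := p - 1)
    (fun u hu => mul_left_cancel₀ hβ (by
      linear_combination hg u hu - deriv g u * hpβ))
  -- Here `g' = d u^(p - 1)`; its antiderivative is logarithmic precisely for `p = 0`, and then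
  -- `hpβ` forces `β (1 - K) = 1`.
  by_cases hp0 : p = 0
  · obtain ⟨g₀, hg₀⟩ := exists_eq_add_of_deriv_eq_hasDerivAt h.isOpen h.isPreconnected h.smooth_g
      (fun u hu => (Real.hasDerivAt_log (ne_of_gt (hpos hu))).const_mul d)
      (fun u hu => by rw [hd u hu, hp0, zero_sub, Real.rpow_neg_one])
    have hKβ : β * (1 - K) = 1 := by rw [hp0] at hpβ; linear_combination -hpβ
    have hK1 : 1 - K ≠ 0 := right_ne_zero_of_mul_eq_one hKβ
    refine ⟨c⁻¹, K, g₀, d, inv_ne_zero hc0, hK, ?_, hf', Or.inr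
      ⟨fun e => hK1 (by rw [e, sub_self]), eq_one_div_of_mul_eq_one_left hKβ, hg₀⟩⟩
    rintro rfl
    exact h.g_nonconstant ⟨g₀, fun u hu => by simp [hg₀ u hu]⟩
  · obtain ⟨g₀, hg₀⟩ := exists_eq_add_of_deriv_eq_hasDerivAt h.isOpen h.isPreconnected h.smooth_g
      (fun u hu => (Real.hasDerivAt_rpow_const (p := p) (Or.inl (ne_of_gt (hpos hu)))).const_mul
        (d / p))
      (fun u hu => by rw [hd u hu]; field_simp)
    refine ⟨c⁻¹, K, g₀, d / p, inv_ne_zero hc0, hK, ?_, hf', Or.inl ⟨hβ, hp0, hg₀⟩⟩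
    intro e
    exact h.g_nonconstant ⟨g₀, fun u hu => by simp [hg₀ u hu, e]⟩

theorem translationField_classification {I : Set ℝ} {f g : ℝ → ℝ} {γ : ℝ}
    (h : Admissible I f g) (hX : IsLieSymmetry I f g (translationField γ)) :
    ∃ f₀ K g₀ g₁ : ℝ, f₀ ≠ 0 ∧ K ≠ 0 ∧ g₁ ≠ 0 ∧ (∀ u ∈ I, f u = f₀ * Real.exp (K * u)) ∧
      ((∃ α₂ : ℝ, α₂ ≠ 0 ∧ K + 2 / α₂ ≠ 0 ∧ γ = α₂ / 2 ∧
          ∀ u ∈ I, g u = g₀ + g₁ * Real.exp (-(K + 2 / α₂) * u)) ∨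
        (γ = -(1 / K) ∧ ∀ u ∈ I, g u = g₀ + g₁ * u)) := by
  rw [translationField_eq] at hX
  have hγ : γ ≠ 0 := by
    rintro rfl
    exact not_isLieSymmetry_affineField_zero h hX
  obtain ⟨κ, hf, hg⟩ := determining_equations h hX
  obtain ⟨K, rfl⟩ : ∃ K, κ = -(K * γ) := ⟨-κ / γ, by field_simp⟩
  obtain ⟨c, hc⟩ := exists_eq_const_mul_exp h.isOpen h.isPreconnected h.smooth_inv (r := -K)
    (fun u hu => mul_left_cancel₀ hγ (by linear_combination hf u hu))
  have hf' : ∀ u ∈ I, f u = c⁻¹ * Real.exp (K * u) := fun u hu => by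
    rw [← inv_inv (f u), hc u hu, mul_inv, neg_mul, Real.exp_neg, inv_inv]
  have hc0 : c ≠ 0 := by
    rintro rfl
    obtain ⟨u, hu⟩ := h.nonempty
    exact h.f_ne_zero u hu (by simp [hf' u hu])
  have hK : K ≠ 0 := by
    rintro rfl
    exact h.f_nonconstant ⟨c⁻¹, fun u hu => by simp [hf' u hu]⟩
  -- The parameter `α₂` is `2 γ`, and `g'` is proportional to `exp (-q u)`; for `q = 0` it is
  -- constant and `K γ = -1`.
  set q := K + 2 / (2 * γ) with hq
  have hqγ : q * γ = K * γ + 1 := by rw [hq]; field_simp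
  obtain ⟨d, hd⟩ := exists_eq_const_mul_exp h.isOpen h.isPreconnected
    (contDiffOn_deriv h.isOpen h.smooth_g) (r := -q)
    (fun u hu => mul_left_cancel₀ hγ (by linear_combination hg u hu + deriv g u * hqγ))
  by_cases hq0 : q = 0
  · obtain ⟨g₀, hg₀⟩ := exists_eq_add_of_deriv_eq_hasDerivAt h.isOpen h.isPreconnected h.smooth_g
      (fun u _ => (hasDerivAt_id u).const_mul d) (fun u hu => by simp [hd u hu, hq0])
    refine ⟨c⁻¹, K, g₀, d, inv_ne_zero hc0, hK, ?_, hf', Or.inr ⟨?_, hg₀⟩⟩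
    · rintro rfl
      exact h.g_nonconstant ⟨g₀, fun u hu => by simp [hg₀ u hu]⟩
    · rw [hq0] at hqγ
      field_simp
      linear_combination -hqγ
  · obtain ⟨g₀, hg₀⟩ := exists_eq_add_of_deriv_eq_hasDerivAt h.isOpen h.isPreconnected h.smooth_g
      (fun u _ => (((hasDerivAt_id u).const_mul (-q)).exp).const_mul (-(d / q)))
      (fun u hu => by rw [hd u hu]; simp only [id]; field_simp)
    refine ⟨c⁻¹, K, g₀, -(d / q), inv_ne_zero hc0, hK, ?_, hf',
      Or.inl ⟨2 * γ, by simpa using hγ, hq0, by ring, hg₀⟩⟩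
    intro e
    exact h.g_nonconstant ⟨g₀, fun u hu => by simp [hg₀ u hu, e]⟩

/-! ### The four families -/

theorem rpow_nonconstant {a b r : ℝ} (hb : b ≠ 0) (hr : r ≠ 0) :
    ¬ ∃ c, ∀ u ∈ Ioi (0 : ℝ), a + b * u ^ r = c := by
  rintro ⟨c, hc⟩
  have h1 := hc 1 (by simp)
  have h2 := hc 2 (by simp)
  rw [← h2, Real.one_rpow] at h1
  have h3 : (2 : ℝ) ^ r = 1 := mul_left_cancel₀ hb (by linarith)
  rw [Real.rpow_def_of_pos two_pos, Real.exp_eq_one_iff] at h3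
  exact mul_ne_zero (Real.log_pos one_lt_two).ne' hr h3

theorem exp_nonconstant {a b r : ℝ} (hb : b ≠ 0) (hr : r ≠ 0) :
    ¬ ∃ c, ∀ u ∈ (univ : Set ℝ), a + b * Real.exp (r * u) = c := by
  rintro ⟨c, hc⟩
  have h1 := hc 0 (by simp)
  have h2 := hc 1 (by simp)
  rw [← h2] at h1
  have h3 : Real.exp (r * 0) = Real.exp (r * 1) := mul_left_cancel₀ hb (by linarith)
  exact hr (by simpa using (Real.exp_injective h3).symm)

theorem admissible_Ioi {f₀ K : ℝ} {g : ℝ → ℝ} (hf₀ : f₀ ≠ 0) (hK : K ≠ 0)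
    (hg : ContDiffOn ℝ ∞ g (Ioi 0)) (hg' : ¬ ∃ c, ∀ u ∈ Ioi (0 : ℝ), g u = c) :
    Admissible (Ioi 0) (fun u => f₀ * u ^ K) g where
  isOpen := isOpen_Ioi
  isPreconnected := isPreconnected_Ioi
  smooth_f := contDiffOn_const.mul
    (fun u hu => (Real.contDiffAt_rpow_const_of_ne (ne_of_gt hu)).contDiffWithinAt)
  smooth_g := hg
  f_ne_zero u hu := mul_ne_zero hf₀ (Real.rpow_pos_of_pos hu K).ne'
  f_nonconstant := by simpa using rpow_nonconstant (a := 0) hf₀ hK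
  g_nonconstant := hg'

theorem admissible_univ {f₀ K : ℝ} {g : ℝ → ℝ} (hf₀ : f₀ ≠ 0) (hK : K ≠ 0)
    (hg : ContDiff ℝ ∞ g) (hg' : ¬ ∃ c, ∀ u ∈ (univ : Set ℝ), g u = c) :
    Admissible univ (fun u => f₀ * Real.exp (K * u)) g where
  isOpen := isOpen_univ
  isPreconnected := isPreconnected_univ
  smooth_f := by fun_prop
  smooth_g := hg.contDiffOn
  f_ne_zero u _ := mul_ne_zero hf₀ (Real.exp_ne_zero _)
  f_nonconstant := by simpa using exp_nonconstant (a := 0) hf₀ hK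
  g_nonconstant := hg'

theorem deriv_inv_rpow {f₀ K u : ℝ} (hu : 0 < u) :
    deriv (fun u => (f₀ * u ^ K)⁻¹) u * u = -K * (f₀ * u ^ K)⁻¹ := by
  have h : HasDerivAt (fun u : ℝ => f₀⁻¹ * u ^ (-K)) (f₀⁻¹ * (-K * u ^ (-K - 1))) u :=
    (Real.hasDerivAt_rpow_const (Or.inl hu.ne')).const_mul _
  have e : (fun u : ℝ => (f₀ * u ^ K)⁻¹) =ᶠ[nhds u] fun u => f₀⁻¹ * u ^ (-K) := by
    filter_upwards [isOpen_Ioi.mem_nhds hu] with w hw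
    rw [mul_inv, Real.rpow_neg (le_of_lt hw)]
  rw [e.deriv_eq, h.deriv, mul_inv, ← Real.rpow_neg hu.le, Real.rpow_sub_one hu.ne']
  field_simp

theorem deriv_inv_exp (f₀ K u : ℝ) :
    deriv (fun u => (f₀ * Real.exp (K * u))⁻¹) u = -K * (f₀ * Real.exp (K * u))⁻¹ := by
  have h : HasDerivAt (fun u : ℝ => f₀⁻¹ * Real.exp (-K * u)) (f₀⁻¹ * (Real.exp (-K * u) * -K)) u :=
    by simpa using (((hasDerivAt_id u).const_mul (-K)).exp).const_mul f₀⁻¹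
  have e : (fun u : ℝ => (f₀ * Real.exp (K * u))⁻¹) = fun u => f₀⁻¹ * Real.exp (-K * u) := by
    funext w
    rw [mul_inv, neg_mul, Real.exp_neg]
  rw [e, h.deriv, mul_inv, neg_mul, Real.exp_neg]
  ring

theorem power_power_case {f₀ K g₀ g₁ β : ℝ} (hf₀ : f₀ ≠ 0) (hK : K ≠ 0) (hg₁ : g₁ ≠ 0)
    (hβ : β ≠ 0) (hp : -(1 / β) - (K - 1) ≠ 0) :
    Admissible (Ioi 0) (fun u => f₀ * u ^ K) (fun u => g₀ + g₁ * u ^ (-(1 / β) - (K - 1))) ∧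
      IsAdditionalSymmetry (Ioi 0) (fun u => f₀ * u ^ K)
        (fun u => g₀ + g₁ * u ^ (-(1 / β) - (K - 1))) (scalingField β) := by
  have h := admissible_Ioi hf₀ hK (contDiffOn_const.add (contDiffOn_const.mul
    (fun u hu => (Real.contDiffAt_rpow_const_of_ne (ne_of_gt hu)).contDiffWithinAt)))
    (rpow_nonconstant (a := g₀) hg₁ hp)
  refine ⟨h, ?_⟩
  rw [scalingField_eq]
  -- The factor `n - 1 + κ = β - 1 - K β` is `β` times the exponent of `g`; the constant `a`
  -- compensates for `g₀`.
  refine isAdditionalSymmetry_affineField h (κ := -K * β)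
    (a := -((β - 1 - K * β) * g₀)) (fun u hu => ?_) (fun u hu => ?_)
  · linear_combination β * deriv_inv_rpow (f₀ := f₀) (K := K) hu
  · have hu0 : u ≠ 0 := ne_of_gt hu
    have hd := (((Real.hasDerivAt_rpow_const (x := u) (p := -(1 / β) - (K - 1))
      (Or.inl hu0)).const_mul g₁).const_add g₀).deriv
    rw [hd, Real.rpow_sub_one hu0]
    field_simp
    ring

theorem power_log_case {f₀ K g₀ g₁ : ℝ} (hf₀ : f₀ ≠ 0) (hK : K ≠ 0) (hK1 : K ≠ 1)
    (hg₁ : g₁ ≠ 0) :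
    Admissible (Ioi 0) (fun u => f₀ * u ^ K) (fun u => g₀ + g₁ * Real.log u) ∧
      IsAdditionalSymmetry (Ioi 0) (fun u => f₀ * u ^ K)
        (fun u => g₀ + g₁ * Real.log u) (scalingField (1 / (1 - K))) := by
  have hK1' : 1 - K ≠ 0 := sub_ne_zero.2 hK1.symm
  have h := admissible_Ioi (g := fun u => g₀ + g₁ * Real.log u) hf₀ hK
    (contDiffOn_const.add (contDiffOn_const.mul
      (fun u hu => (Real.contDiffAt_log.2 (ne_of_gt hu)).contDiffWithinAt))) (by
    rintro ⟨c, hc⟩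
    have h1 := hc 1 (by simp)
    have h2 := hc 2 (by simp)
    rw [← h2, Real.log_one] at h1
    have h3 : Real.log 2 = 0 := mul_left_cancel₀ hg₁ (by linarith)
    exact (Real.log_pos one_lt_two).ne' h3)
  refine ⟨h, ?_⟩
  rw [scalingField_eq]
  -- Here `n - 1 + κ = 0`, so `g' η` has to equal the constant `a`.
  refine isAdditionalSymmetry_affineField h (κ := -K * (1 / (1 - K)))
    (a := g₁ * (1 / (1 - K))) (fun u hu => ?_) (fun u hu => ?_)
  · linear_combination (1 / (1 - K)) * deriv_inv_rpow (f₀ := f₀) (K := K) hu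
  · have hu0 : u ≠ 0 := ne_of_gt hu
    rw [(((Real.hasDerivAt_log hu0).const_mul g₁).const_add g₀).deriv]
    field_simp
    ring

theorem exp_exp_case {f₀ K g₀ g₁ α : ℝ} (hf₀ : f₀ ≠ 0) (hK : K ≠ 0) (hg₁ : g₁ ≠ 0)
    (hα : α ≠ 0) (hp : K + 2 / α ≠ 0) :
    Admissible univ (fun u => f₀ * Real.exp (K * u))
        (fun u => g₀ + g₁ * Real.exp (-(K + 2 / α) * u)) ∧
      IsAdditionalSymmetry univ (fun u => f₀ * Real.exp (K * u))
        (fun u => g₀ + g₁ * Real.exp (-(K + 2 / α) * u)) (translationField (α / 2)) := by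
  have h := admissible_univ hf₀ hK (by fun_prop) (exp_nonconstant (a := g₀) hg₁ (neg_ne_zero.2 hp))
  refine ⟨h, ?_⟩
  rw [translationField_eq]
  refine isAdditionalSymmetry_affineField h (κ := -K * (α / 2))
    (a := -((-1 - K * (α / 2)) * g₀)) (fun u _ => ?_) (fun u _ => ?_)
  · linear_combination (α / 2) * deriv_inv_exp f₀ K u
  · have hd := ((((hasDerivAt_id u).const_mul (-(K + 2 / α))).exp.const_mul g₁).const_add g₀).deriv
    simp only [id] at hd
    rw [hd]
    field_simp
    ring

theorem exp_linear_case {f₀ K g₀ g₁ : ℝ} (hf₀ : f₀ ≠ 0) (hK : K ≠ 0) (hg₁ : g₁ ≠ 0) :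
    Admissible univ (fun u => f₀ * Real.exp (K * u)) (fun u => g₀ + g₁ * u) ∧
      IsAdditionalSymmetry univ (fun u => f₀ * Real.exp (K * u))
        (fun u => g₀ + g₁ * u) (translationField (-(1 / K))) := by
  have h := admissible_univ (g := fun u => g₀ + g₁ * u) hf₀ hK (by fun_prop) (by
    rintro ⟨c, hc⟩
    have h1 := hc 0 (mem_univ _)
    have h2 := hc 1 (mem_univ _)
    exact hg₁ (by linarith))
  refine ⟨h, ?_⟩
  rw [translationField_eq]
  -- With `γ = -1/K` one has `κ = -K γ = 1`, so the coefficient `n - 1 + κ` of `g` vanishes and `a =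
  -- g₁ γ`.
  refine isAdditionalSymmetry_affineField h (κ := 1)
    (a := -(g₁ / K)) (fun u _ => ?_) (fun u _ => ?_)
  · rw [deriv_inv_exp]
    field_simp
    ring
  · have hd := (((hasDerivAt_id u).const_mul g₁).const_add g₀).deriv
    simp only [id] at hd
    rw [hd]
    field_simp
    ring

theorem proposition2 :
    -- arbitrary functions: invariance under the four-dimensional algebra
    (∀ (I : Set ℝ) (f g : ℝ → ℝ), Admissible I f g →
      ∀ X ∈ Submodule.span ℝ {Y₁, Y₂, Y₃, Y₄}, IsLieSymmetry I f g X) ∧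
    (LinearIndependent ℝ ![Y₁, Y₂, Y₃, Y₄] ∧
      bracket Y₁ Y₂ = 0 ∧ bracket Y₁ Y₃ = 0 ∧ bracket Y₂ Y₃ = 0 ∧
      bracket Y₁ Y₄ = Y₁ ∧ bracket Y₂ Y₄ = Y₂ ∧ bracket Y₃ Y₄ = -Y₃ ∧
      IsA45 (-1) 1 (Submodule.span ℝ {Y₁, Y₂, Y₃, Y₄})) ∧
    -- two powers
    (∀ f₀ K g₀ g₁ α₁ : ℝ, f₀ ≠ 0 → K ≠ 0 → g₁ ≠ 0 → α₁ ≠ 0 → -(1 / α₁) - (K - 1) ≠ 0 →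
      Admissible (Set.Ioi 0) (fun u => f₀ * u ^ K)
        (fun u => g₀ + g₁ * u ^ (-(1 / α₁) - (K - 1))) ∧
      IsAdditionalSymmetry (Set.Ioi 0) (fun u => f₀ * u ^ K)
        (fun u => g₀ + g₁ * u ^ (-(1 / α₁) - (K - 1))) (scalingField α₁)) ∧
    -- a power and a logarithm
    (∀ f₀ K g₀ g₁ : ℝ, f₀ ≠ 0 → K ≠ 0 → K ≠ 1 → g₁ ≠ 0 →
      Admissible (Set.Ioi 0) (fun u => f₀ * u ^ K) (fun u => g₀ + g₁ * Real.log u) ∧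
      IsAdditionalSymmetry (Set.Ioi 0) (fun u => f₀ * u ^ K)
        (fun u => g₀ + g₁ * Real.log u) (scalingField (1 / (1 - K)))) ∧
    -- two exponentials
    (∀ f₀ K g₀ g₁ α₂ : ℝ, f₀ ≠ 0 → K ≠ 0 → g₁ ≠ 0 → α₂ ≠ 0 → K + 2 / α₂ ≠ 0 →
      Admissible Set.univ (fun u => f₀ * Real.exp (K * u))
        (fun u => g₀ + g₁ * Real.exp (-(K + 2 / α₂) * u)) ∧
      IsAdditionalSymmetry Set.univ (fun u => f₀ * Real.exp (K * u))
        (fun u => g₀ + g₁ * Real.exp (-(K + 2 / α₂) * u)) (translationField (α₂ / 2))) ∧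
    -- an exponential and a linear function
    (∀ f₀ K g₀ g₁ : ℝ, f₀ ≠ 0 → K ≠ 0 → g₁ ≠ 0 →
      Admissible Set.univ (fun u => f₀ * Real.exp (K * u)) (fun u => g₀ + g₁ * u) ∧
      IsAdditionalSymmetry Set.univ (fun u => f₀ * Real.exp (K * u))
        (fun u => g₀ + g₁ * u) (translationField (-(1 / K)))) ∧
    -- only the first two families admit a symmetry `y ∂_y + β u ∂_u`
    (∀ (I : Set ℝ) (f g : ℝ → ℝ) (β : ℝ), I ⊆ Set.Ioi 0 → Admissible I f g →
      IsLieSymmetry I f g (scalingField β) →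
      ∃ f₀ K g₀ g₁ : ℝ, f₀ ≠ 0 ∧ K ≠ 0 ∧ g₁ ≠ 0 ∧ (∀ u ∈ I, f u = f₀ * u ^ K) ∧
        ((β ≠ 0 ∧ -(1 / β) - (K - 1) ≠ 0 ∧ ∀ u ∈ I, g u = g₀ + g₁ * u ^ (-(1 / β) - (K - 1))) ∨
          (K ≠ 1 ∧ β = 1 / (1 - K) ∧ ∀ u ∈ I, g u = g₀ + g₁ * Real.log u))) ∧
    -- only the last two families admit a symmetry `y ∂_y + γ ∂_u`
    (∀ (I : Set ℝ) (f g : ℝ → ℝ) (γ : ℝ), Admissible I f g →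
      IsLieSymmetry I f g (translationField γ) →
      ∃ f₀ K g₀ g₁ : ℝ, f₀ ≠ 0 ∧ K ≠ 0 ∧ g₁ ≠ 0 ∧ (∀ u ∈ I, f u = f₀ * Real.exp (K * u)) ∧
        ((∃ α₂ : ℝ, α₂ ≠ 0 ∧ K + 2 / α₂ ≠ 0 ∧ γ = α₂ / 2 ∧
            ∀ u ∈ I, g u = g₀ + g₁ * Real.exp (-(K + 2 / α₂) * u)) ∨
          (γ = -(1 / K) ∧ ∀ u ∈ I, g u = g₀ + g₁ * u))) := by
  exact ⟨fun _ _ _ h _ hX => isLieSymmetry_of_mem_span_basicFields h hX,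
    ⟨linearIndependent_basicFields, bracket_Y₁_Y₂, bracket_Y₁_Y₃, bracket_Y₂_Y₃, bracket_Y₁_Y₄,
      bracket_Y₂_Y₄, bracket_Y₃_Y₄, isA45_basicFields⟩,
    fun _ _ _ _ _ hf₀ hK hg₁ hβ hp => power_power_case hf₀ hK hg₁ hβ hp,
    fun _ _ _ _ hf₀ hK hK1 hg₁ => power_log_case hf₀ hK hK1 hg₁,
    fun _ _ _ _ _ hf₀ hK hg₁ hα hp => exp_exp_case hf₀ hK hg₁ hα hp,
    fun _ _ _ _ hf₀ hK hg₁ => exp_linear_case hf₀ hK hg₁,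
    fun _ _ _ _ hpos h hX => scalingField_classification hpos h hX,
    fun _ _ _ _ h hX => translationField_classification h hX⟩
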